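/- Let $N\ge 2$, $T>0$, $r_0>0$, and let $A_\epsilon(t)=A_0+\epsilon A_1(t)+\epsilon^2A_2(t)+\dots\in\mathbb C^{N\times N}$, where the series converges for all $t\in\mathbb R$ and all $\epsilon\in\mathbb C$ with $|\epsilon|<r_0$ ($r_0$ independent of $t$), $A_\epsilon(t)$ is $T$-periodic in $t$ and jointly continuous in $(\epsilon,t)$, $A_0$ is constant and diagonal, and each $A_n$, $n\ge1$, has a finite Fourier series of period $T$. Write $A_1(t)=\sum_{m\in\mathbb Z}e^{2\pi \mathrm i mt/T}A_1^{(m)}$. Let $F_0$ be a diagonal matrix with $(A_0)_{kk}=(F_0)_{kk}+\frac{2\pi \mathrm i}{T}n_k$, $n_k\in\mathbb Z$ (the folding numbers), such that no two distinct diagonal entries of $F_0$ differ by an element of $\frac{2\pi \mathrm i}{T}\mathbb Z$; for instance, the choice with all $\operatorname{Im}(F_0)_{kk}\in[-\pi/T,\pi/T)$, or the one with all $\operatorname{Im}(F_0)_{kk}\in(-\pi/T,\pi/T]$. Suppose that $(F_0)_{ii}=(F_0)_{jj}$, $i\ne j$, is a double eigenvalue of $F_0$ (no other diagonal entry equals it).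 Then for $\epsilon$ near $0$ there are matrices $F_\epsilon$ and $T$-periodic matrix functions $P_\epsilon(t)$, depending analytically on $\epsilon$, with $F_\epsilon|_{\epsilon=0}=F_0$, such that $P_\epsilon(t)\exp(F_\epsilon t)$ is the fundamental solution of $dx/dt=A_\epsilon(t)x$ (equal to $\mathrm{Id}$ at $t=0$). For every such analytic decomposition, writing $F_\epsilon=F_0+\epsilon F_1+O(\epsilon^2)$, the following holds. 1. The first order effective Hamiltonian associated to $(F_0)_{ii}$, i.e. the restriction of $F_0+\epsilon F_1$ to $\operatorname{span}\{e_k:(F_0)_{kk}=(F_0)_{ii}\}=\operatorname{span}\{e_i,e_j\}$, is $$\begin{pmatrix}(F_0)_{ii}&0\\0&(F_0)_{jj}\end{pmatrix}+\epsilon\begin{pmatrix}(A_1^{(0)})_{ii}&(A_1^{(n_i-n_j)})_{ij}\\(A_1^{(n_j-n_i)})_{ji}&(A_1^{(0)})_{jj}\end{pmatrix}.$$ 2. Up to first order in $\epsilon$, the Floquet exponents (eigenvalues of $F_\epsilon$) associated to $(F_0)_{ii}$ are $$(F_0)_{ii}+\epsilon\left(\frac{(A_1^{(0)})_{ii}+(A_1^{(0)})_{jj}}2\pm\sqrt{\Big(\frac{(A_1^{(0)})_{ii}-(A_1^{(0)})_{jj}}2\Big)^2+(A_1^{(n_i-n_j)})_{ij}(A_1^{(n_j-n_i)})_{ji}}\right).$$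 Precisely: for some $\delta>0$ and all $\epsilon$ near $0$, the eigenvalues of $F_\epsilon$ at distance less than $\delta$ from $(F_0)_{ii}$, counted with algebraic multiplicity, are two numbers $\mu_1(\epsilon),\mu_2(\epsilon)$ that equal the two displayed expressions up to an error $o(\epsilon)$ as $\epsilon\to0$. The error is $O(\epsilon^2)$ whenever the $2\times2$ matrix multiplying $\epsilon$ in 1 is diagonalizable, that is, whenever the square root is nonzero or both off-diagonal entries vanish. -/

import Mathlib

open Filter Topology Asymptotics

noncomputable section

namespace FloquetPerturbation

variable {ι : Type*} [Fintype ι] [DecidableEq ι]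

/-- `f` has a finite Fourier series with period `T`:
`f t = ∑ m, exp (2πi m t / T) • c m`, with only finitely many nonzero matrices `c m`. -/
def HasFiniteFourierSeries (T : ℝ) (f : ℝ → Matrix ι ι ℂ) : Prop :=
  ∃ c : ℤ →₀ Matrix ι ι ℂ, ∀ t : ℝ,
    f t = c.sum fun m C => Complex.exp (2 * Real.pi * Complex.I * m * t / T) • C

/-- The `m`-th Fourier coefficient of a `T`-periodic matrix-valued function, that is, the matrix
with entries `(1 / T) ∫₀ᵀ exp (-2πi m t / T) f(t)ₖₗ dt`. -/
def fourierCoefficient {T : ℝ} (hT : 0 < T) (f : ℝ → Matrix ι ι ℂ) (m : ℤ) : Matrix ι ι ℂ :=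
  Matrix.of fun k l => fourierCoeffOn hT (fun t => f t k l) m

/-- The coefficient matrices `A ε t = ∑ n, ε ^ n • a n t` form a continuous `T`-periodic family,
analytic in `ε` on the disc `‖ε‖ < r₀` (the same for all times `t`), whose constant order Taylor
coefficient is the constant diagonal matrix with entries `α`, and all of whose other Taylor
coefficients have finite Fourier series. -/
structure IsAnalyticPeriodicFamily (T r₀ : ℝ) (A : ℂ → ℝ → Matrix ι ι ℂ)
    (a : ℕ → ℝ → Matrix ι ι ℂ) (α : ι → ℂ) : Prop where
  periodic : ∀ ε ∈ Metric.ball (0 : ℂ) r₀, Function.Periodic (A ε) T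
  continuousOn :
    ContinuousOn (fun p : ℂ × ℝ => A p.1 p.2) (Metric.ball (0 : ℂ) r₀ ×ˢ Set.univ)
  hasSum : ∀ ε ∈ Metric.ball (0 : ℂ) r₀, ∀ t : ℝ, HasSum (fun n => ε ^ n • a n t) (A ε t)
  constant_order : ∀ t : ℝ, a 0 t = Matrix.diagonal α
  higher_order : ∀ n : ℕ, 1 ≤ n → HasFiniteFourierSeries T (a n)

/-- The diagonal matrix with entries `φ` is an admissible constant order Floquet exponent matrix
for the diagonal matrix with entries `α`, with folding numbers `n`: the entries satisfy
`α k = φ k + n k (2πi / T)`, and no two distinct entries of `φ` are congruent modulo `2πi / T`.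
Both `Im (φ k) ∈ [-π/T, π/T)` for all `k` and `Im (φ k) ∈ (-π/T, π/T]` for all `k` are choices of
this kind. -/
structure IsConstantOrderExponent (T : ℝ) (α φ : ι → ℂ) (n : ι → ℤ) : Prop where
  folding : ∀ k, α k = φ k + n k * (2 * Real.pi * Complex.I / T)
  nonresonant : ∀ k l, ∀ m : ℤ, φ k - φ l = m * (2 * Real.pi * Complex.I / T) → φ k = φ l

/-- `X` is the fundamental solution of `dx/dt = A(t) x`, normalized by `X(0) = Id`. -/
structure IsFundamentalSolution (A X : ℝ → Matrix ι ι ℂ) : Prop where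
  initial : X 0 = 1
  hasDerivAt : ∀ t k l, HasDerivAt (fun s => X s k l) ((A t * X t) k l) t

/-- `P` is `T`-periodic and `P(t) exp(F t)` is the fundamental solution of `dx/dt = A(t) x`. -/
structure IsFloquetDecomposition (T : ℝ) (A P : ℝ → Matrix ι ι ℂ) (F : Matrix ι ι ℂ) : Prop where
  periodic : Function.Periodic P T
  fundamental : IsFundamentalSolution A fun t => P t * NormedSpace.exp ((t : ℂ) • F)

/-- `F ε`, `P ε` is a Floquet decomposition of `dx/dt = A ε (t) x` for `ε` near `0`, depending
analytically on `ε`, with constant order exponent matrix `F 0` equal to the diagonal matrix with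
entries `φ`. -/
def IsAnalyticFloquetDecomposition (T : ℝ) (A : ℂ → ℝ → Matrix ι ι ℂ) (φ : ι → ℂ)
    (F : ℂ → Matrix ι ι ℂ) (P : ℂ → ℝ → Matrix ι ι ℂ) : Prop :=
  F 0 = Matrix.diagonal φ ∧
  ∃ r : ℝ, 0 < r ∧
    (∀ k l, AnalyticOnNhd ℂ (fun ε => F ε k l) (Metric.ball 0 r)) ∧
    (∀ t k l, AnalyticOnNhd ℂ (fun ε => P ε t k l) (Metric.ball 0 r)) ∧
    ∀ ε ∈ Metric.ball (0 : ℂ) r, IsFloquetDecomposition T (A ε) (P ε) (F ε)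

/-- The coefficient `F₁` in `F ε = F₀ + ε F₁ + O(ε²)`. -/
def firstOrderCoefficient (F : ℂ → Matrix ι ι ℂ) : Matrix ι ι ℂ :=
  Matrix.of fun k l => deriv (fun ε => F ε k l) 0

/-- The first order effective Hamiltonian associated to the `i`-th diagonal entry of the diagonal
matrix `M₀` with entries `φ`: the matrix `M₀ + ε M₁` restricted to the span of the basis vectors
`e k` with `φ k = φ i`. -/
def effectiveHamiltonian (φ : ι → ℂ) (M₁ : Matrix ι ι ℂ) (i : ι) (ε : ℂ) :
    Matrix {k : ι // φ k = φ i} {k : ι // φ k = φ i} ℂ :=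
  (Matrix.diagonal φ + ε • M₁).submatrix Subtype.val Subtype.val

/-- The eigenvalues of `M` at distance less than `δ` from `c`, with algebraic multiplicity. -/
def eigenvaluesNear (M : Matrix ι ι ℂ) (c : ℂ) (δ : ℝ) : Multiset ℂ :=
  M.charpoly.roots.filter fun z => ‖z - c‖ < δ

end FloquetPerturbation

end

/-! Let `X ε` be the fundamental solution. Since `P ε T = P ε 0 = 1`, every Floquet decomposition
satisfies `exp (T F ε) = X ε T`, and both sides are time-`T` values of linear systems that are
constant and diagonal at `ε = 0`. First order variation of constants
(`IsBoundedHolomorphicFamily.hasDerivAt_solution`) gives the derivative of the `(k, l)` entry as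
`exp (β k T) ∫₀ᵀ exp ((β l - β k) s) A₁(s)ₖₗ ds`, with `β = φ` and constant `A₁ = F₁` on the left,
and `β = α` on the right. The prefactors agree. If `φ k = φ l`, the left integral is `T (F₁)ₖₗ`,
while on the right `α l - α k = -(n k - n l) 2πi / T` turns the integral into `T` times a Fourier
coefficient.

Existence: the same formula shows that the derivative of `F ↦ exp (T F)` at `diagonal φ` multiplies
each entry by a scalar, nonzero by nonresonance, so the exponential has a local analytic inverse
(`exists_analytic_log`), which is applied to `X ε T`.

Eigenvalues: an invariant graph, obtained from a Riccati equation, splits off a `2 × 2` block `φ i +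
ε B + O(ε²)`, the complementary block having no eigenvalue near `φ i`. The quadratic formula for
this block gives the two exponents; the size of the error depends on how the square root of the
discriminant behaves. -/

namespace FloquetPerturbation

/-! ### Linear differential equations with a holomorphic parameter: the Dyson series. -/

section LinearODE

open MeasureTheory

/-- Cauchy's estimate on circles of radius `ρ / 2` bounds the derivative by `C / (ρ / 2)`, with `C`
a bound for `f` on a compact set. This constant is the dominating function for differentiation under
the integral. -/
theorem hasDerivAt_intervalIntegral_of_differentiableOn {E : Type*} [NormedAddCommGroup E]
    [NormedSpace ℂ E] [CompleteSpace E] {f : ℂ → ℝ → E} (hf : Continuous f.uncurry)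
    {U : Set ℂ} (hU : IsOpen U) (hd : ∀ t, DifferentiableOn ℂ (fun z => f z t) U) (a b : ℝ)
    {z : ℂ} (hz : z ∈ U) :
    HasDerivAt (fun z => ∫ t in a..b, f z t) (∫ t in a..b, deriv (fun w => f w t) z) z := by
  obtain ⟨ρ, hρ, hρU⟩ := Metric.nhds_basis_closedBall.mem_iff.1 (hU.mem_nhds hz)
  obtain ⟨C, hC⟩ := ((isCompact_closedBall z ρ).prod (isCompact_uIcc (a := a) (b := b))
    ).exists_bound_of_continuousOn hf.continuousOn
  refine (intervalIntegral.hasDerivAt_integral_of_dominated_loc_of_deriv_le (F := f)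
    (F' := fun w t => deriv (fun w => f w t) w) (bound := fun _ => C / (ρ / 2))
    (Metric.ball_mem_nhds z (half_pos hρ)) ?_ ?_ ?_ ?_ ?_ ?_).2
  · exact Eventually.of_forall fun w =>
      (hf.comp (Continuous.prodMk_right w)).aestronglyMeasurable
  · exact (hf.comp (Continuous.prodMk_right z)).intervalIntegrable _ _
  · have h : Continuous (Function.uncurry fun t w => f w t) := hf.comp continuous_swap
    exact ((stronglyMeasurable_deriv_with_param h).comp_measurable
      (measurable_id.prodMk measurable_const)).aestronglyMeasurable
  · refine Eventually.of_forall fun t ht w hw => ?_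
    have hsub : Metric.closedBall w (ρ / 2) ⊆ Metric.closedBall z ρ := by
      refine Metric.closedBall_subset_closedBall' ?_
      have := Metric.mem_ball.1 hw
      linarith
    refine Complex.norm_deriv_le_of_forall_mem_sphere_norm_le (half_pos hρ) ?_ ?_
    · refine DifferentiableOn.diffContOnCl ((hd t).mono ?_)
      rw [closure_ball w (half_pos hρ).ne']
      exact hsub.trans hρU
    · intro v hv
      exact hC (v, t) ⟨hsub (Metric.sphere_subset_closedBall hv), Set.uIoc_subset_uIcc ht⟩
  · exact intervalIntegrable_const
  · refine Eventually.of_forall fun t _ w hw => ?_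
    refine ((hd t).differentiableAt (hU.mem_nhds (hρU ?_))).hasDerivAt
    exact Metric.closedBall_subset_closedBall (by linarith) (Metric.ball_subset_closedBall hw)

variable {𝔸 : Type*} [NormedRing 𝔸] [NormedAlgebra ℂ 𝔸]

/-- The terms of the Dyson series of `dx/dt = A z (t) x`. -/
noncomputable def dysonTerm (A : ℂ → ℝ → 𝔸) : ℕ → ℂ → ℝ → 𝔸
  | 0, _, _ => 1
  | n + 1, z, t => ∫ s in (0 : ℝ)..t, A z s * dysonTerm A n z s

theorem continuous_dysonTerm {A : ℂ → ℝ → 𝔸} (hA : Continuous A.uncurry) (n : ℕ) :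
    Continuous (dysonTerm A n).uncurry := by
  induction n with
  | zero => exact continuous_const
  | succ n ih =>
    have h : Continuous (Function.uncurry fun (p : ℂ × ℝ) s => A p.1 s * dysonTerm A n p.1 s) := by
      have : Continuous fun q : (ℂ × ℝ) × ℝ => (q.1.1, q.2) := by fun_prop
      exact (hA.comp this).mul (ih.comp this)
    exact intervalIntegral.continuous_parametric_intervalIntegral_of_continuous (a₀ := 0) h
      continuous_snd

theorem hasDerivAt_dysonTerm_succ [CompleteSpace 𝔸] {A : ℂ → ℝ → 𝔸}
    (hA : Continuous A.uncurry) (n : ℕ) (z : ℂ) (t : ℝ) : HasDerivAt (dysonTerm A (n + 1) z) (A z t * dysonTerm A n z t) t := by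
  have h : Continuous fun s => A z s * dysonTerm A n z s :=
    (hA.comp (Continuous.prodMk_right z)).mul
      ((continuous_dysonTerm hA n).comp (Continuous.prodMk_right z))
  exact h.integral_hasStrictDerivAt 0 t |>.hasDerivAt

theorem differentiableOn_dysonTerm [CompleteSpace 𝔸] {A : ℂ → ℝ → 𝔸}
    (hA : Continuous A.uncurry) {U : Set ℂ} (hU : IsOpen U) (hd : ∀ t, DifferentiableOn ℂ (fun z => A z t) U) (n : ℕ) (t : ℝ) :
    DifferentiableOn ℂ (fun z => dysonTerm A n z t) U := by
  induction n generalizing t with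
  | zero => exact differentiableOn_const _
  | succ n ih =>
    intro z hz
    exact (hasDerivAt_intervalIntegral_of_differentiableOn
      (f := fun z s => A z s * dysonTerm A n z s) (hA.mul (continuous_dysonTerm hA n)) hU
      (fun s => (hd s).mul (ih s)) 0 t hz).differentiableAt.differentiableWithinAt

theorem norm_dysonTerm_le {A : ℂ → ℝ → 𝔸} {M : ℝ} (hM : ∀ z t, ‖A z t‖ ≤ M) (n : ℕ) (z : ℂ)
    (t : ℝ) : ‖dysonTerm A n z t‖ ≤ ‖(1 : 𝔸)‖ * ((M * |t|) ^ n / n.factorial) := by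
  have hM0 : 0 ≤ M := (norm_nonneg _).trans (hM 0 0)
  induction n generalizing t with
  | zero => simp [dysonTerm]
  | succ n ih =>
    have hb : ∀ s, ‖A z s * dysonTerm A n z s‖ ≤
        (‖(1 : 𝔸)‖ * (M ^ (n + 1) / n.factorial)) * |s - 0| ^ n := fun s => by
      refine (norm_mul_le _ _).trans ((mul_le_mul (hM z s) (ih s) (norm_nonneg _) hM0).trans_eq ?_)
      rw [sub_zero, mul_pow]; ring
    calc ‖dysonTerm A (n + 1) z t‖
        ≤ |∫ s in (0 : ℝ)..t, (‖(1 : 𝔸)‖ * (M ^ (n + 1) / n.factorial)) * |s - 0| ^ n| := by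
          refine intervalIntegral.norm_integral_le_abs_of_norm_le (Eventually.of_forall fun s => hb s) ?_
          exact Continuous.intervalIntegrable (by fun_prop) _ _
      _ = ‖(1 : 𝔸)‖ * ((M * |t|) ^ (n + 1) / (n + 1).factorial) := by
          rw [intervalIntegral.integral_const_mul, abs_mul, intervalIntegral.abs_intervalIntegral_eq,
            integral_pow_abs_sub_uIoc,
            abs_of_nonneg (by positivity), abs_of_nonneg (by positivity), Nat.factorial_succ]
          push_cast
          rw [sub_zero, mul_pow]
          field_simp

/-- On bounded time intervals the Dyson series is majorized by an exponential series, uniformly in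
`z`. This majorant yields joint continuity, termwise differentiation in `t` and holomorphy in `z`.
-/
theorem exists_linearODE_solution [CompleteSpace 𝔸] {A : ℂ → ℝ → 𝔸}
    (hA : Continuous A.uncurry) {M : ℝ} (hM : ∀ z t, ‖A z t‖ ≤ M) {U : Set ℂ} (hU : IsOpen U)
    (hd : ∀ t, DifferentiableOn ℂ (fun z => A z t) U) :
    ∃ X : ℂ → ℝ → 𝔸, Continuous X.uncurry ∧ (∀ z, X z 0 = 1) ∧
      (∀ z t, HasDerivAt (X z) (A z t * X z t) t) ∧
      ∀ t, DifferentiableOn ℂ (fun z => X z t) U := by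
  have hM0 : 0 ≤ M := (norm_nonneg _).trans (hM 0 0)
  have hsum : ∀ R : ℝ, Summable fun n : ℕ => ‖(1 : 𝔸)‖ * ((M * R) ^ n / n.factorial) := fun R =>
    (Real.summable_pow_div_factorial _).mul_left _
  have hbound : ∀ R : ℝ, ∀ n z t, |t| ≤ R →
      ‖dysonTerm A n z t‖ ≤ ‖(1 : 𝔸)‖ * ((M * R) ^ n / n.factorial) := fun R n z t ht =>
    (norm_dysonTerm_le hM n z t).trans (by gcongr)
  have hsummable : ∀ z t, Summable fun n => dysonTerm A n z t := fun z t =>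
    .of_norm_bounded (hsum |t|) fun n => hbound _ n z t le_rfl
  refine ⟨fun z t => ∑' n, dysonTerm A n z t, ?_, fun z => ?_, fun z t => ?_, fun t => ?_⟩
  · refine continuous_iff_continuousAt.2 fun p => ?_
    have hopen : IsOpen {q : ℂ × ℝ | |q.2| < |p.2| + 1} :=
      isOpen_lt (by fun_prop) continuous_const
    have hcont : ContinuousOn (fun q : ℂ × ℝ => ∑' n, dysonTerm A n q.1 q.2)
        {q : ℂ × ℝ | |q.2| < |p.2| + 1} :=
      continuousOn_tsum (fun n => (continuous_dysonTerm hA n).continuousOn) (hsum (|p.2| + 1))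
        fun n q hq => hbound _ n q.1 q.2 (le_of_lt hq)
    exact hcont.continuousAt (hopen.mem_nhds (lt_add_one |p.2|))
  · refine (tsum_eq_single 0 fun n hn => ?_).trans rfl
    obtain ⟨m, rfl⟩ := Nat.exists_eq_succ_of_ne_zero hn
    simp [dysonTerm]
  -- Differentiation shifts the index by one: the derivative of term `m + 1` is `A` times term `m`,
  -- and that of the constant term `0` vanishes.
  · let g' : ℕ → ℝ → 𝔸 := fun n s => Nat.casesOn n 0 fun m => A z s * dysonTerm A m z s
    have hg : ∀ n s, HasDerivAt (dysonTerm A n z) (g' n s) s := fun n s => by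
      cases n with
      | zero => exact hasDerivAt_const s (1 : 𝔸)
      | succ n => exact hasDerivAt_dysonTerm_succ hA n z s
    let u : ℕ → ℝ := fun n => Nat.casesOn n 0 fun m =>
      M * (‖(1 : 𝔸)‖ * ((M * (|t| + 1)) ^ m / m.factorial))
    have hu : Summable u := (summable_nat_add_iff 1).1 ((hsum _).mul_left M)
    have hmem : ∀ s ∈ Metric.ball t 1, |s| ≤ |t| + 1 := fun s hs => by
      have h1 := Metric.mem_ball.1 hs
      rw [Real.dist_eq] at h1
      have := abs_sub_abs_le_abs_sub s t
      linarith
    have hgu : ∀ n s, s ∈ Metric.ball t 1 → ‖g' n s‖ ≤ u n := fun n s hs => by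
      cases n with
      | zero => simp [g', u]
      | succ n =>
        exact (norm_mul_le _ _).trans
          (mul_le_mul (hM z s) (hbound _ n z s (hmem s hs)) (norm_nonneg _) hM0)
    have htt : t ∈ Metric.ball t (1 : ℝ) := Metric.mem_ball_self one_pos
    have hder := hasDerivAt_tsum_of_isPreconnected hu Metric.isOpen_ball
      (convex_ball t (1 : ℝ)).isPreconnected (fun n s _ => hg n s) hgu htt (hsummable z t) htt
    have htsum : ∑' n, g' n t = A z t * ∑' n, dysonTerm A n z t := by
      rw [(Summable.of_norm_bounded hu fun n => hgu n t htt).tsum_eq_zero_add,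
        ← (hsummable z t).tsum_mul_left]
      simp [g']
    rwa [htsum] at hder
  · exact Complex.differentiableOn_tsum_of_summable_norm (hsum |t|)
      (fun n => differentiableOn_dysonTerm hA hU hd n t) hU fun n z _ => hbound _ n z t le_rfl

theorem linearODE_solution_unique {B X Y : ℝ → 𝔸} {M : ℝ} (hM : ∀ t, ‖B t‖ ≤ M)
    (hX : ∀ t, HasDerivAt X (B t * X t) t) (hY : ∀ t, HasDerivAt Y (B t * Y t) t)
    (h0 : X 0 = Y 0) : X = Y := by
  have hM0 : 0 ≤ M := (norm_nonneg _).trans (hM 0)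
  refine ODE_solution_unique_univ (v := fun t x => B t * x) (s := fun _ => Set.univ)
    (K := ⟨M, hM0⟩) (t₀ := 0) (fun t => LipschitzOnWith.of_dist_le_mul fun x _ y _ => ?_)
    (fun t => ⟨hX t, trivial⟩) (fun t => ⟨hY t, trivial⟩) h0
  rw [dist_eq_norm, dist_eq_norm, ← mul_sub]
  exact (norm_mul_le _ _).trans (mul_le_mul_of_nonneg_right (hM t) (norm_nonneg _))

end LinearODE

/-! ### Coefficients defined only on a disc of parameters. -/

section HolomorphicFamily

variable {𝔸 : Type*} [NormedRing 𝔸] [NormedAlgebra ℂ 𝔸]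

/-- A bounded family of time dependent coefficients, continuous on a closed disc of parameters
and holomorphic in its interior. -/
structure IsBoundedHolomorphicFamily (r M : ℝ) (A : ℂ → ℝ → 𝔸) : Prop where
  pos : 0 < r
  continuousOn : ContinuousOn A.uncurry (Metric.closedBall 0 r ×ˢ Set.univ)
  norm_le : ∀ z ∈ Metric.closedBall (0 : ℂ) r, ∀ t, ‖A z t‖ ≤ M
  differentiableOn : ∀ t, DifferentiableOn ℂ (fun z => A z t) (Metric.ball 0 r)

/-- Composition with the radial retraction of `ℂ` onto the closed disc keeps continuity and the
bound. The retraction is the identity on the open disc, so holomorphy survives there. -/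
theorem IsBoundedHolomorphicFamily.exists_extension {r M : ℝ} {A : ℂ → ℝ → 𝔸}
    (hA : IsBoundedHolomorphicFamily r M A) :
    ∃ A' : ℂ → ℝ → 𝔸, Continuous A'.uncurry ∧ (∀ z t, ‖A' z t‖ ≤ M) ∧
      (∀ z ∈ Metric.ball (0 : ℂ) r, A' z = A z) ∧
      ∀ t, DifferentiableOn ℂ (fun z => A' z t) (Metric.ball 0 r) := by
  have hr := hA.pos
  have hmax : ∀ z : ℂ, 0 < max r ‖z‖ := fun z => lt_max_of_lt_left hr
  let ρ : ℂ → ℂ := fun z => ((r / max r ‖z‖ : ℝ) : ℂ) * z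
  have hρc : Continuous ρ := by
    refine (Complex.continuous_ofReal.comp ?_).mul continuous_id
    exact continuous_const.div (by fun_prop) fun z => (hmax z).ne'
  have hρm : ∀ z, ρ z ∈ Metric.closedBall (0 : ℂ) r := fun z => by
    rw [mem_closedBall_zero_iff, norm_mul, Complex.norm_real, Real.norm_of_nonneg
      (div_pos hr (hmax z)).le, div_mul_eq_mul_div, div_le_iff₀ (hmax z)]
    exact mul_le_mul_of_nonneg_left (le_max_right _ _) hr.le
  have hρe : ∀ z ∈ Metric.ball (0 : ℂ) r, ρ z = z := fun z hz => by
    have : max r ‖z‖ = r := max_eq_left (mem_ball_zero_iff.1 hz).le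
    simp [ρ, this, hr.ne']
  have heq : ∀ z ∈ Metric.ball (0 : ℂ) r, A (ρ z) = A z := fun z hz => by rw [hρe z hz]
  refine ⟨fun z => A (ρ z), ?_, fun z => hA.norm_le _ (hρm z), heq, fun t => ?_⟩
  · exact hA.continuousOn.comp_continuous (f := fun p : ℂ × ℝ => (ρ p.1, p.2)) (by fun_prop)
      fun p => ⟨hρm p.1, trivial⟩
  · exact (hA.differentiableOn t).congr fun z hz => congrFun (heq z hz) t

theorem IsBoundedHolomorphicFamily.exists_solution [CompleteSpace 𝔸] {r M : ℝ} {A : ℂ → ℝ → 𝔸}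
    (hA : IsBoundedHolomorphicFamily r M A) :
    ∃ X : ℂ → ℝ → 𝔸, Continuous X.uncurry ∧ (∀ z, X z 0 = 1) ∧
      (∀ z ∈ Metric.ball (0 : ℂ) r, ∀ t, HasDerivAt (X z) (A z t * X z t) t) ∧
      ∀ t, DifferentiableOn ℂ (fun z => X z t) (Metric.ball 0 r) := by
  obtain ⟨A', hc, hM, heq, hd⟩ := hA.exists_extension
  obtain ⟨X, hX, h0, hder, hXd⟩ := exists_linearODE_solution hc hM Metric.isOpen_ball hd
  exact ⟨X, hX, h0, fun z hz t => heq z hz ▸ hder z t, hXd⟩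

end HolomorphicFamily

/-! ### First order perturbation of a constant diagonal system. -/

section FirstOrder

attribute [local instance] Matrix.linftyOpNormedRing Matrix.linftyOpNormedAlgebra

variable {ι : Type*} [Fintype ι]

/-- The evaluation of a matrix at an entry, as a continuous linear map. -/
noncomputable def entryCLM (k l : ι) : Matrix ι ι ℂ →L[ℂ] ℂ :=
  LinearMap.toContinuousLinearMap (Matrix.entryLinearMap ℂ ℂ k l)

theorem hasDerivAt_entry [DecidableEq ι] {X : ℂ → Matrix ι ι ℂ} {X' : Matrix ι ι ℂ} {z : ℂ}
    (h : HasDerivAt X X' z) (k l : ι) : HasDerivAt (fun w => X w k l) (X' k l) z :=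
  (entryCLM k l).hasFDerivAt.comp_hasDerivAt z h

theorem hasDerivAt_real_entry [DecidableEq ι] {X : ℝ → Matrix ι ι ℂ} {X' : Matrix ι ι ℂ} {t : ℝ}
    (h : HasDerivAt X X' t) (k l : ι) : HasDerivAt (fun s => X s k l) (X' k l) t :=
  ((entryCLM k l).restrictScalars ℝ).hasFDerivAt.comp_hasDerivAt t h

theorem hasDerivAt_of_entry {X : ℝ → Matrix ι ι ℂ} {X' : Matrix ι ι ℂ} {t : ℝ}
    (h : ∀ k l, HasDerivAt (fun s => X s k l) (X' k l) t) : HasDerivAt X X' t :=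
  hasDerivAt_pi.2 fun k => hasDerivAt_pi.2 fun l => h k l

theorem analyticAt_of_entry [DecidableEq ι] {X : ℂ → Matrix ι ι ℂ} {z : ℂ}
    (h : ∀ k l, AnalyticAt ℂ (fun s => X s k l) z) : AnalyticAt ℂ X z := by
  have h1 : X = fun w => ∑ k, ∑ l, X w k l • Matrix.single k l (1 : ℂ) := by
    ext1 w
    conv_lhs => rw [Matrix.matrix_eq_sum_single (X w)]
    simp [Matrix.smul_single]
  rw [h1]
  exact Finset.analyticAt_fun_sum _ fun k _ => Finset.analyticAt_fun_sum _ fun l _ =>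
    (h k l).smul analyticAt_const

theorem hasDerivAt_exp_mul_ofReal (c : ℂ) (t : ℝ) :
    HasDerivAt (fun s : ℝ => Complex.exp (c * s)) (c * Complex.exp (c * t)) t := by
  have h := ((hasDerivAt_id (t : ℂ)).const_mul c).cexp.comp_ofReal
  simpa [mul_comm] using h

variable [DecidableEq ι]

theorem diagonal_linearODE_solution {β : ι → ℂ} {X : ℝ → Matrix ι ι ℂ} (h0 : X 0 = 1)
    (hX : ∀ t, HasDerivAt X (Matrix.diagonal β * X t) t) (t : ℝ) :
    X t = Matrix.diagonal fun k => Complex.exp (β k * t) := by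
  have hD : ∀ t : ℝ, HasDerivAt (fun s : ℝ => Matrix.diagonal fun k => Complex.exp (β k * s))
      (Matrix.diagonal β * Matrix.diagonal fun k => Complex.exp (β k * t)) t := fun t => by
    refine hasDerivAt_of_entry fun k l => ?_
    rw [Matrix.diagonal_mul_diagonal]
    by_cases hkl : k = l
    · subst hkl
      simpa using hasDerivAt_exp_mul_ofReal (β k) t
    · simpa [hkl] using hasDerivAt_const t (0 : ℂ)
  refine congrFun (linearODE_solution_unique (B := fun _ => Matrix.diagonal β)
    (M := ‖Matrix.diagonal β‖) (fun _ => le_rfl) hX hD ?_) t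
  simp [h0]

/-- First order perturbation of the fundamental solution around a constant diagonal system. -/
theorem IsBoundedHolomorphicFamily.hasDerivAt_solution {r M : ℝ} {A : ℂ → ℝ → Matrix ι ι ℂ}
    (hA : IsBoundedHolomorphicFamily r M A) {β : ι → ℂ} (hβ : ∀ t, A 0 t = Matrix.diagonal β)
    {X : ℂ → ℝ → Matrix ι ι ℂ}
    (hX : ∀ᶠ z in 𝓝 (0 : ℂ), X z 0 = 1 ∧ ∀ t, HasDerivAt (X z) (A z t * X z t) t)
    (T : ℝ) (k l : ι) :
    HasDerivAt (fun z => X z T k l) (Complex.exp (β k * T) *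
      ∫ s in (0 : ℝ)..T, Complex.exp ((β l - β k) * s) * deriv (fun z => A z s k l) 0) 0 := by
  obtain ⟨A', hA'c, hA'M, hA'eq, hA'd⟩ := hA.exists_extension
  obtain ⟨Y, hYc, hY0, hYder, hYd⟩ := exists_linearODE_solution hA'c hA'M Metric.isOpen_ball hA'd
  have hball : Metric.ball (0 : ℂ) r ∈ 𝓝 (0 : ℂ) := Metric.ball_mem_nhds 0 hA.pos
  have h0mem : (0 : ℂ) ∈ Metric.ball (0 : ℂ) r := Metric.mem_ball_self hA.pos
  have hA'0 : ∀ t, A' 0 t = Matrix.diagonal β := fun t => by rw [hA'eq 0 h0mem, hβ t]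
  have hXY : (fun z => X z T k l) =ᶠ[𝓝 0] fun z => Y z T k l := by
    filter_upwards [hX, hball] with z hz hzr
    have hzder : ∀ t, HasDerivAt (X z) (A' z t * X z t) t := hA'eq z hzr ▸ hz.2
    rw [linearODE_solution_unique (hA'M z) hzder (hYder z) (hz.1.trans (hY0 z).symm)]
  have hYz : ∀ t, Y 0 t = Matrix.diagonal fun k => Complex.exp (β k * t) :=
    diagonal_linearODE_solution (hY0 0) fun t => hA'0 t ▸ hYder 0 t
  -- Variation of constants: `f z s` is the derivative in `s` of `exp (-β k s) * Y z s k l`, because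
  -- the diagonal part of the equation cancels.
  let f : ℂ → ℝ → ℂ := fun z s => Complex.exp (-β k * s) * ((A' z s - A' 0 s) * Y z s) k l
  have hfc : Continuous f.uncurry := by
    have h1 : Continuous fun p : ℂ × ℝ => A' 0 p.2 :=
      hA'c.comp (g := A'.uncurry) (f := fun p : ℂ × ℝ => ((0 : ℂ), p.2)) (by fun_prop)
    have h2 : Continuous fun p : ℂ × ℝ => entryCLM k l ((A' p.1 p.2 - A' 0 p.2) * Y p.1 p.2) :=
      (entryCLM k l).continuous.comp ((hA'c.sub h1).mul hYc)
    exact Continuous.mul (by fun_prop) h2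
  have hfd : ∀ s, DifferentiableOn ℂ (fun z => f z s) (Metric.ball 0 r) := fun s => by
    refine DifferentiableOn.const_mul ?_ _
    exact (entryCLM k l).differentiable.comp_differentiableOn
      (((hA'd s).sub (differentiableOn_const _)).mul (hYd s))
  have hrepr : ∀ z, Y z T k l =
      Complex.exp (β k * T) * ((1 : Matrix ι ι ℂ) k l + ∫ s in (0 : ℝ)..T, f z s) := fun z => by
    have hder : ∀ s : ℝ, HasDerivAt (fun s : ℝ => Complex.exp (-β k * s) * Y z s k l) (f z s) s :=
      fun s => by
        refine ((hasDerivAt_exp_mul_ofReal (-β k) s).mul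
          (hasDerivAt_real_entry (hYder z s) k l)).congr_deriv ?_
        simp only [f, sub_mul, Matrix.sub_apply, hA'0, Matrix.diagonal_mul]
        ring
    rw [intervalIntegral.integral_eq_sub_of_hasDerivAt (fun s _ => hder s)
      ((hfc.comp (Continuous.prodMk_right z)).intervalIntegrable _ _), hY0]
    have h1 : Complex.exp (β k * T) * Complex.exp (-β k * T) = 1 := by
      rw [← Complex.exp_add]; simp
    simp only [Complex.ofReal_zero, mul_zero, Complex.exp_zero, one_mul]
    rw [add_sub_cancel, ← mul_assoc, h1, one_mul]
  -- The factor `A' z s - A' 0 s` vanishes at `z = 0`, so the derivative of `Y` does not contribute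
  -- and only the diagonal matrix `Y 0 s` enters.
  have hderiv : ∀ s : ℝ, deriv (fun z => f z s) 0 =
      Complex.exp ((β l - β k) * s) * deriv (fun z => A z s k l) 0 := fun s => by
    have hAd : HasDerivAt (fun z => A' z s) (deriv (fun z => A' z s) 0) 0 :=
      ((hA'd s).differentiableAt hball).hasDerivAt
    have hYs : HasDerivAt (fun z => Y z s) (deriv (fun z => Y z s) 0) 0 :=
      ((hYd s).differentiableAt hball).hasDerivAt
    have hent : deriv (fun z => A z s k l) 0 = deriv (fun z => A' z s) 0 k l := by
      refine (HasDerivAt.congr_of_eventuallyEq (hasDerivAt_entry hAd k l) ?_).deriv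
      filter_upwards [hball] with z hz
      rw [hA'eq z hz]
    have h := (hasDerivAt_entry ((hAd.sub_const (A' 0 s)).mul hYs) k l).const_mul
      (Complex.exp (-β k * s))
    refine h.deriv.trans ?_
    rw [sub_self, zero_mul, add_zero, hYz, Matrix.mul_diagonal, hent, sub_mul, Complex.exp_sub,
      neg_mul, Complex.exp_neg]
    ring
  refine HasDerivAt.congr_of_eventuallyEq ?_ hXY
  simp_rw [hrepr, ← hderiv]
  exact ((hasDerivAt_intervalIntegral_of_differentiableOn hfc Metric.isOpen_ball hfd 0 T
    h0mem).const_add _).const_mul _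

end FirstOrder

/-! ### The monodromy matrix and the first order coefficient of the exponent. -/

section Decomposition

attribute [local instance] Matrix.linftyOpNormedRing Matrix.linftyOpNormedAlgebra

/-- Convergence at a real point `ρ < r` makes the terms there tend to zero, so the radius of
convergence is at least `ρ`. -/
theorem exists_hasFPowerSeriesOnBall_of_hasSum {E : Type*} [NormedAddCommGroup E]
    [NormedSpace ℂ E] {c : ℕ → E} {f : ℂ → E} {r : ℝ} (hr : 0 < r)
    (h : ∀ z ∈ Metric.ball (0 : ℂ) r, HasSum (fun n => z ^ n • c n) (f z)) :
    ∃ p : FormalMultilinearSeries ℂ ℂ E,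
      HasFPowerSeriesOnBall f p 0 (ENNReal.ofReal r) ∧ ∀ n, p.coeff n = c n := by
  let p : FormalMultilinearSeries ℂ ℂ E := fun n => ContinuousMultilinearMap.mkPiRing ℂ (Fin n) (c n)
  refine ⟨p, ⟨?_, ENNReal.ofReal_pos.2 hr, fun {y} hy => ?_⟩, fun n => ?_⟩
  · refine le_of_forall_lt fun q hq => ?_
    obtain ⟨ρ, hqρ, hρ⟩ := ENNReal.lt_iff_exists_nnreal_btwn.1 hq
    refine hqρ.trans_le (p.le_radius_of_tendsto (l := 0) ?_)
    have hmem : ((ρ : ℝ) : ℂ) ∈ Metric.ball (0 : ℂ) r := by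
      rw [mem_ball_zero_iff, Complex.norm_real, NNReal.norm_eq]
      exact (ENNReal.lt_ofReal_iff_toReal_lt ENNReal.coe_ne_top).1 hρ
    refine (h _ hmem).summable.tendsto_atTop_zero.norm.congr' ?_ |>.trans (by simp)
    refine Eventually.of_forall fun n => ?_
    simp only [p, ContinuousMultilinearMap.norm_mkPiRing, norm_smul, norm_pow, Complex.norm_real,
      NNReal.norm_eq, mul_comm]
  · have hy' : y ∈ Metric.ball (0 : ℂ) r := by
      rwa [← Metric.eball_ofReal]
    simpa [p] using h y hy'
  · simp [p, FormalMultilinearSeries.coeff]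

theorem exists_norm_le_of_periodic {E : Type*} [NormedAddCommGroup E] {A : ℂ → ℝ → E} {T r : ℝ}
    (hT : 0 < T) (hA : ContinuousOn A.uncurry (Metric.closedBall 0 r ×ˢ Set.univ))
    (hper : ∀ z ∈ Metric.closedBall (0 : ℂ) r, Function.Periodic (A z) T) :
    ∃ M, ∀ z ∈ Metric.closedBall (0 : ℂ) r, ∀ t, ‖A z t‖ ≤ M := by
  obtain ⟨M, hM⟩ := ((isCompact_closedBall (0 : ℂ) r).prod (isCompact_Icc (a := (0 : ℝ)) (b := T))
    ).exists_bound_of_continuousOn (hA.mono (Set.prod_mono_right (Set.subset_univ _)))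
  refine ⟨M, fun z hz t => ?_⟩
  obtain ⟨s, hs, hst⟩ := (hper z hz).exists_mem_Ico₀ hT t
  rw [hst]
  exact hM (z, s) ⟨hz, Set.Ico_subset_Icc_self hs⟩

theorem IsAnalyticPeriodicFamily.apply_zero {ι : Type*} [DecidableEq ι] {T r₀ : ℝ} (hr₀ : 0 < r₀)
    {A : ℂ → ℝ → Matrix ι ι ℂ} {a : ℕ → ℝ → Matrix ι ι ℂ} {α : ι → ℂ}
    (hA : IsAnalyticPeriodicFamily T r₀ A a α) (t : ℝ) : A 0 t = Matrix.diagonal α := by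
  have h := hA.hasSum 0 (Metric.mem_ball_self hr₀) t
  have h2 := hasSum_single (f := fun n => (0 : ℂ) ^ n • a n t) 0 fun n hn => by simp [hn]
  simpa [hA.constant_order t] using h.unique h2

theorem fourierCoefficient_apply {ι : Type*} {T : ℝ} (hT : 0 < T) (f : ℝ → Matrix ι ι ℂ)
    (m : ℤ) (k l : ι) : fourierCoefficient hT f m k l = (T : ℂ)⁻¹ *
      ∫ s in (0 : ℝ)..T, Complex.exp (-m * (2 * Real.pi * Complex.I / T) * s) * f s k l := by
  rw [fourierCoefficient, Matrix.of_apply, fourierCoeffOn_eq_integral]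
  simp only [sub_zero, one_div, Complex.real_smul, Complex.ofReal_inv, smul_eq_mul]
  congr 1
  refine intervalIntegral.integral_congr fun s _ => ?_
  rw [fourier_coe_apply]
  congr 2
  push_cast
  ring

variable {ι : Type*} [Fintype ι] [DecidableEq ι]

theorem IsAnalyticPeriodicFamily.isBoundedHolomorphicFamily {T r₀ : ℝ} (hT : 0 < T) (hr₀ : 0 < r₀)
    {A : ℂ → ℝ → Matrix ι ι ℂ} {a : ℕ → ℝ → Matrix ι ι ℂ} {α : ι → ℂ}
    (hA : IsAnalyticPeriodicFamily T r₀ A a α) :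
    ∃ M, IsBoundedHolomorphicFamily (r₀ / 2) M A := by
  have hsub : Metric.closedBall (0 : ℂ) (r₀ / 2) ⊆ Metric.ball 0 r₀ :=
    Metric.closedBall_subset_ball (half_lt_self hr₀)
  have hc : ContinuousOn A.uncurry (Metric.closedBall 0 (r₀ / 2) ×ˢ Set.univ) :=
    hA.continuousOn.mono (Set.prod_mono_left hsub)
  obtain ⟨M, hM⟩ := exists_norm_le_of_periodic hT hc fun z hz => hA.periodic z (hsub hz)
  refine ⟨M, half_pos hr₀, hc, hM, fun t => ?_⟩
  obtain ⟨p, hp, -⟩ := exists_hasFPowerSeriesOnBall_of_hasSum hr₀ fun z hz => hA.hasSum z hz t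
  have := hp.differentiableOn
  rw [Metric.eball_ofReal] at this
  exact this.mono (Metric.ball_subset_closedBall.trans hsub)

theorem IsAnalyticPeriodicFamily.deriv_entry {T r₀ : ℝ} (hr₀ : 0 < r₀)
    {A : ℂ → ℝ → Matrix ι ι ℂ} {a : ℕ → ℝ → Matrix ι ι ℂ} {α : ι → ℂ}
    (hA : IsAnalyticPeriodicFamily T r₀ A a α) (t : ℝ) (k l : ι) :
    deriv (fun z => A z t k l) 0 = a 1 t k l := by
  obtain ⟨p, hp, hp1⟩ := exists_hasFPowerSeriesOnBall_of_hasSum hr₀ fun z hz => hA.hasSum z hz t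
  have h := hp.hasFPowerSeriesAt.hasDerivAt
  exact (hasDerivAt_entry h k l).deriv.trans (congrFun (congrFun (hp1 1) k) l)

theorem isFundamentalSolution_iff {A X : ℝ → Matrix ι ι ℂ} :
    IsFundamentalSolution A X ↔ X 0 = 1 ∧ ∀ t, HasDerivAt X (A t * X t) t :=
  ⟨fun h => ⟨h.initial, fun t => hasDerivAt_of_entry (h.hasDerivAt t)⟩,
    fun h => ⟨h.1, fun t => hasDerivAt_real_entry (h.2 t)⟩⟩

theorem hasDerivAt_exp_ofReal_smul (F : Matrix ι ι ℂ) (t : ℝ) :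
    HasDerivAt (fun s : ℝ => NormedSpace.exp ((s : ℂ) • F))
      (F * NormedSpace.exp ((t : ℂ) • F)) t :=
  ((hasDerivAt_exp_smul_const' F (t : ℂ)).scomp t Complex.ofRealCLM.hasDerivAt).congr_deriv
    (by rw [Complex.ofRealCLM_apply, Complex.ofReal_one, one_smul]; rfl)

/-- Seen as coefficients constant in time, `F z` has fundamental solution `exp (t F z)`, so the
perturbation formula for systems also covers the matrix exponential. -/
theorem isBoundedHolomorphicFamily_const {F : ℂ → Matrix ι ι ℂ} (hF : AnalyticAt ℂ F 0) :
    ∃ r M, IsBoundedHolomorphicFamily r M fun z (_ : ℝ) => F z := by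
  obtain ⟨r, hr, hball⟩ := Metric.nhds_basis_closedBall.eventually_iff.1
    hF.eventually_analyticAt
  have hc : ContinuousOn F (Metric.closedBall 0 r) := fun z hz =>
    (hball hz).continuousAt.continuousWithinAt
  obtain ⟨M, hM⟩ := (isCompact_closedBall (0 : ℂ) r).exists_bound_of_continuousOn hc
  exact ⟨r, M, hr, hc.comp continuousOn_fst fun p hp => hp.1, fun z hz _ => hM z hz, fun _ z hz =>
    (hball (Metric.ball_subset_closedBall hz)).differentiableAt.differentiableWithinAt⟩

/-- First order perturbation of the matrix exponential around a diagonal matrix. -/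
theorem hasDerivAt_exp_smul_entry {F : ℂ → Matrix ι ι ℂ} (hF : AnalyticAt ℂ F 0) {φ : ι → ℂ}
    (hφ : F 0 = Matrix.diagonal φ) (T : ℝ) (k l : ι) :
    HasDerivAt (fun z => NormedSpace.exp ((T : ℂ) • F z) k l) (Complex.exp (φ k * T) *
      ((∫ s in (0 : ℝ)..T, Complex.exp ((φ l - φ k) * s)) * deriv (fun z => F z k l) 0)) 0 := by
  obtain ⟨r, M, h⟩ := isBoundedHolomorphicFamily_const hF
  rw [← intervalIntegral.integral_mul_const]
  exact h.hasDerivAt_solution (fun _ => hφ) (X := fun z t => NormedSpace.exp ((t : ℂ) • F z))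
    (Eventually.of_forall fun z => ⟨by simp, hasDerivAt_exp_ofReal_smul (F z)⟩) T k l

/-- Periodicity and the normalization at `0` give `P T = P 0 = 1`. Thus the monodromy matrix is `exp
(T F)`. -/
theorem IsFloquetDecomposition.exp_smul_eq {T : ℝ} {A P : ℝ → Matrix ι ι ℂ} {F : Matrix ι ι ℂ}
    (h : IsFloquetDecomposition T A P F) :
    P T * NormedSpace.exp ((T : ℂ) • F) = NormedSpace.exp ((T : ℂ) • F) := by
  have h0 : P 0 = 1 := by simpa using h.fundamental.initial
  have hT : P T = 1 := by simpa [h0] using h.periodic 0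
  rw [hT, one_mul]

theorem IsAnalyticFloquetDecomposition.analyticAt {T : ℝ} {A : ℂ → ℝ → Matrix ι ι ℂ} {φ : ι → ℂ}
    {F : ℂ → Matrix ι ι ℂ} {P : ℂ → ℝ → Matrix ι ι ℂ}
    (h : IsAnalyticFloquetDecomposition T A φ F P) : AnalyticAt ℂ F 0 := by
  obtain ⟨-, r, hr, hF, -⟩ := h
  exact analyticAt_of_entry fun k l => hF k l 0 (Metric.mem_ball_self hr)

/-- The entries of the first order coefficient of the exponent matrix in the blocks belonging to
the eigenvalues of its constant order. -/
theorem IsAnalyticFloquetDecomposition.firstOrderCoefficient_apply {T r₀ : ℝ} (hT : 0 < T)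
    (hr₀ : 0 < r₀) {A : ℂ → ℝ → Matrix ι ι ℂ} {a : ℕ → ℝ → Matrix ι ι ℂ} {α : ι → ℂ}
    (hA : IsAnalyticPeriodicFamily T r₀ A a α) {φ : ι → ℂ} {n : ι → ℤ}
    (hφ : IsConstantOrderExponent T α φ n) {F : ℂ → Matrix ι ι ℂ} {P : ℂ → ℝ → Matrix ι ι ℂ}
    (h : IsAnalyticFloquetDecomposition T A φ F P) {k l : ι} (hkl : φ k = φ l) :
    firstOrderCoefficient F k l = fourierCoefficient hT (a 1) (n k - n l) k l := by
  have hTc : (T : ℂ) ≠ 0 := Complex.ofReal_ne_zero.2 hT.ne'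
  obtain ⟨M, hM⟩ := hA.isBoundedHolomorphicFamily hT hr₀
  have h1 := hasDerivAt_exp_smul_entry h.analyticAt h.1 T k l
  obtain ⟨-, r, hr, -, -, hdec⟩ := h
  have h2 := hM.hasDerivAt_solution (hA.apply_zero hr₀)
    (X := fun z t => P z t * NormedSpace.exp ((t : ℂ) • F z))
    (by
      filter_upwards [Metric.ball_mem_nhds (0 : ℂ) hr] with z hz
      exact isFundamentalSolution_iff.1 (hdec z hz).fundamental) T k l
  -- Both formulas differentiate the same monodromy entry, once through the exponent matrix and once
  -- through the differential equation.
  have h12 := h1.unique (h2.congr_of_eventuallyEq (by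
    filter_upwards [Metric.ball_mem_nhds (0 : ℂ) hr] with z hz
    rw [(hdec z hz).exp_smul_eq]))
  have hexp : Complex.exp (α k * T) = Complex.exp (φ k * T) := by
    rw [hφ.folding k, Complex.exp_eq_exp_iff_exists_int]
    exact ⟨n k, by field_simp⟩
  -- Since `φ k = φ l`, only the folding numbers survive; they select the Fourier mode.
  have hdiff : α l - α k = -((n k - n l : ℤ) : ℂ) * (2 * Real.pi * Complex.I / T) := by
    rw [hφ.folding k, hφ.folding l, hkl]
    push_cast
    ring
  rw [hexp] at h12
  have h3 := mul_left_cancel₀ (Complex.exp_ne_zero _) h12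
  simp only [hkl, sub_self, zero_mul, Complex.exp_zero, intervalIntegral.integral_const, sub_zero,
    hA.deriv_entry hr₀, Complex.real_smul, mul_one] at h3
  rw [fourierCoefficient_apply, ← hdiff, ← h3, firstOrderCoefficient, Matrix.of_apply,
    inv_mul_cancel_left₀ hTc]

end Decomposition

/-! ### Existence of an analytic Floquet decomposition. -/

section Existence

attribute [local instance] Matrix.linftyOpNormedRing Matrix.linftyOpNormedAlgebra

/-- For `c ≠ 0` the integral is `(exp (c T) - 1) / c`, which vanishes only if `c T` is a multiple of
`2πi`. -/
theorem integral_exp_mul_ne_zero {T : ℝ} (hT : 0 < T) {c : ℂ}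
    (hc : ∀ m : ℤ, c = m * (2 * Real.pi * Complex.I / T) → c = 0) :
    ∫ s in (0 : ℝ)..T, Complex.exp (c * s) ≠ 0 := by
  have hTc : (T : ℂ) ≠ 0 := Complex.ofReal_ne_zero.2 hT.ne'
  rcases eq_or_ne c 0 with rfl | h0
  · simpa using hT.ne'
  · rw [integral_exp_mul_complex h0, Complex.ofReal_zero, mul_zero, Complex.exp_zero]
    refine div_ne_zero (fun h => h0 ?_) h0
    obtain ⟨m, hm⟩ := Complex.exp_eq_one_iff.1 (sub_eq_zero.1 h)
    refine hc m ?_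
    rw [← mul_div_assoc, eq_div_iff hTc, hm]

variable {ι : Type*} [Fintype ι] [DecidableEq ι]

theorem exp_smul_diagonal (φ : ι → ℂ) (t : ℝ) :
    NormedSpace.exp ((t : ℂ) • Matrix.diagonal φ) =
      Matrix.diagonal fun k => Complex.exp (φ k * t) :=
  diagonal_linearODE_solution (X := fun t : ℝ => NormedSpace.exp ((t : ℂ) • Matrix.diagonal φ))
    (by simp) (hasDerivAt_exp_ofReal_smul _) t

theorem analyticAt_exp_smul (c : ℂ) (F : Matrix ι ι ℂ) :
    AnalyticAt ℂ (fun F : Matrix ι ι ℂ => NormedSpace.exp (c • F)) F :=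
  (NormedSpace.exp_analytic (𝕂 := ℂ) (c • F)).comp (f := fun F : Matrix ι ι ℂ => c • F)
    (analyticAt_const.fun_smul analyticAt_id)

theorem analyticAt_entry {X : ℂ → Matrix ι ι ℂ} {z : ℂ} (h : AnalyticAt ℂ X z) (k l : ι) :
    AnalyticAt ℂ (fun w => X w k l) z :=
  ((entryCLM k l).analyticAt (X z)).comp h

theorem exp_mul_exp_neg (F : Matrix ι ι ℂ) : NormedSpace.exp F * NormedSpace.exp (-F) = 1 := by
  rw [← Matrix.exp_add_of_commute _ _ (Commute.refl F).neg_right, add_neg_cancel,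
    NormedSpace.exp_zero]

/-- The matrix exponential has a local analytic inverse at a diagonal matrix whose entries are
nonresonant. -/
theorem exists_analytic_log {T : ℝ} (hT : 0 < T) {φ : ι → ℂ}
    (hφ : ∀ k l, ∀ m : ℤ, φ k - φ l = m * (2 * Real.pi * Complex.I / T) → φ k = φ l) :
    ∃ G : Matrix ι ι ℂ → Matrix ι ι ℂ,
      AnalyticAt ℂ G (NormedSpace.exp ((T : ℂ) • Matrix.diagonal φ)) ∧
      G (NormedSpace.exp ((T : ℂ) • Matrix.diagonal φ)) = Matrix.diagonal φ ∧
      ∀ᶠ Y in 𝓝 (NormedSpace.exp ((T : ℂ) • Matrix.diagonal φ)),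
        NormedSpace.exp ((T : ℂ) • G Y) = Y := by
  let E : Matrix ι ι ℂ → Matrix ι ι ℂ := fun F => NormedSpace.exp ((T : ℂ) • F)
  have hE : AnalyticAt ℂ E (Matrix.diagonal φ) := analyticAt_exp_smul _ _
  have hd : HasFDerivAt E (fderiv ℂ E (Matrix.diagonal φ)) (Matrix.diagonal φ) :=
    hE.differentiableAt.hasFDerivAt
  -- Along the line `diagonal φ + z • H` the derivative multiplies `H k l` by `exp (φ k T) ∫₀ᵀ exp
  -- ((φ l - φ k) s) ds`, which nonresonance makes nonzero.
  have hinj : Function.Injective (fderiv ℂ E (Matrix.diagonal φ)).toLinearMap := by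
    refine (injective_iff_map_eq_zero _).2 fun H hH => ?_
    have hline : HasDerivAt (fun z : ℂ => Matrix.diagonal φ + z • H) H 0 := by
      have h := ((hasDerivAt_id (0 : ℂ)).smul_const H).const_add (Matrix.diagonal φ)
      rw [one_smul] at h
      exact h
    have han : AnalyticAt ℂ (fun z : ℂ => Matrix.diagonal φ + z • H) 0 :=
      analyticAt_const.add (analyticAt_id.smul analyticAt_const)
    have hcomp : HasDerivAt (fun z : ℂ => E (Matrix.diagonal φ + z • H)) 0 0 := by
      have h0 : HasFDerivAt E (fderiv ℂ E (Matrix.diagonal φ))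
          (Matrix.diagonal φ + (0 : ℂ) • H) := by simpa using hd
      exact (h0.comp_hasDerivAt (0 : ℂ) hline).congr_deriv hH
    ext k l
    have h := (hasDerivAt_exp_smul_entry han (φ := φ) (by simp) T k l).unique
      (hasDerivAt_entry hcomp k l)
    rw [(hasDerivAt_entry hline k l).deriv] at h
    have hint : ∫ s in (0 : ℝ)..T, Complex.exp ((φ l - φ k) * s) ≠ 0 :=
      integral_exp_mul_ne_zero hT fun m hm => sub_eq_zero.2 (hφ l k m hm)
    simpa [Complex.exp_ne_zero, hint] using h
  let e := (LinearEquiv.ofInjectiveEndo _ hinj).toContinuousLinearEquiv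
  have hd' : HasFDerivAt E (e : Matrix ι ι ℂ →L[ℂ] Matrix ι ι ℂ) (Matrix.diagonal φ) :=
    hd.congr_fderiv (by ext1 H; rfl)
  have hs : HasStrictFDerivAt E (e : Matrix ι ι ℂ →L[ℂ] Matrix ι ι ℂ) (Matrix.diagonal φ) :=
    hE.contDiffAt.hasStrictFDerivAt' hd' (n := 1) one_ne_zero
  refine ⟨hs.localInverse E e _, ?_, hs.localInverse_apply_image, hs.eventually_right_inverse⟩
  -- The smoothness exponent `⊤` means analytic here, not merely `C^∞`.
  exact (ContDiffAt.to_localInverse (n := ⊤) hE.contDiffAt hd' (by simp)).analyticAt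

/-- Take for `F z` the local logarithm of `X z T`, divided by `T`, and `P z t = X z t * exp (-t F
z)`. Periodicity of `P z` follows from `X z (t + T) = X z t * X z T` and `X z T = exp (T F z)`. -/
theorem exists_isAnalyticFloquetDecomposition {T r₀ : ℝ} (hT : 0 < T)
    (hr₀ : 0 < r₀) {A : ℂ → ℝ → Matrix ι ι ℂ} {a : ℕ → ℝ → Matrix ι ι ℂ} {α : ι → ℂ}
    (hA : IsAnalyticPeriodicFamily T r₀ A a α) {φ : ι → ℂ} {n : ι → ℤ}
    (hφ : IsConstantOrderExponent T α φ n) :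
    ∃ F P, IsAnalyticFloquetDecomposition T A φ F P := by
  obtain ⟨M, hM⟩ := hA.isBoundedHolomorphicFamily hT hr₀
  obtain ⟨X, -, hX0, hX, hXd⟩ := hM.exists_solution
  obtain ⟨G, hG, hG0, hGe⟩ := exists_analytic_log hT hφ.nonresonant
  have h0mem : (0 : ℂ) ∈ Metric.ball (0 : ℂ) (r₀ / 2) := Metric.mem_ball_self hM.pos
  have hXan : ∀ t, ∀ z ∈ Metric.ball (0 : ℂ) (r₀ / 2), AnalyticAt ℂ (fun z => X z t) z :=
    fun t z hz => (hXd t).analyticAt (Metric.isOpen_ball.mem_nhds hz)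
  have hXT : X 0 T = NormedSpace.exp ((T : ℂ) • Matrix.diagonal φ) := by
    rw [diagonal_linearODE_solution (hX0 0) (fun t => hA.apply_zero hr₀ t ▸ hX 0 h0mem t) T,
      exp_smul_diagonal]
    congr 1
    ext k
    rw [hφ.folding k, Complex.exp_eq_exp_iff_exists_int]
    have hTc : (T : ℂ) ≠ 0 := Complex.ofReal_ne_zero.2 hT.ne'
    exact ⟨n k, by field_simp⟩
  rw [← hXT] at hG hG0 hGe
  have hFan : AnalyticAt ℂ (fun z => G (X z T)) 0 := hG.comp (f := fun z => X z T) (hXan T 0 h0mem)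
  have hFe : ∀ᶠ z in 𝓝 (0 : ℂ), NormedSpace.exp ((T : ℂ) • G (X z T)) = X z T :=
    (hXan T 0 h0mem).continuousAt.eventually hGe
  obtain ⟨r, hr, hball⟩ := Metric.eventually_nhds_iff_ball.1
    (hFan.eventually_analyticAt.and (hFe.and (Metric.isOpen_ball.mem_nhds h0mem)))
  refine ⟨fun z => G (X z T), fun z t => X z t * NormedSpace.exp (-(t : ℂ) • G (X z T)), hG0, r, hr,
    fun k l z hz => analyticAt_entry (hball z hz).1 k l, fun t k l z hz => ?_, fun z hz => ?_⟩
  · obtain ⟨h1, -, h3⟩ := hball z hz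
    exact analyticAt_entry ((hXan t z h3).mul
      ((analyticAt_exp_smul (-(t : ℂ)) _).comp (f := fun z => G (X z T)) h1)) k l
  · obtain ⟨-, h2, h3⟩ := hball z hz
    have hzA : ∀ t, ‖A z t‖ ≤ M := hM.norm_le z (Metric.ball_subset_closedBall h3)
    have hzper : Function.Periodic (A z) T :=
      hA.periodic z (Metric.ball_subset_ball (half_le_self hr₀.le) h3)
    -- By periodicity of `A z` both sides solve the same equation, and they agree at `t = 0`.
    have hmono : ∀ t, X z (t + T) = X z t * X z T := congrFun (linearODE_solution_unique hzA
      (fun t => by simpa [hzper t] using (hX z h3 (t + T)).comp_add_const t T)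
      (fun t => by simpa [mul_assoc] using (hX z h3 t).mul_const (X z T)) (by simp [hX0]))
    refine ⟨fun t => ?_, isFundamentalSolution_iff.2 ⟨by simp [hX0], fun t => ?_⟩⟩
    · have hsplit : -((t + T : ℝ) : ℂ) • G (X z T) =
          -((T : ℂ) • G (X z T)) + -(t : ℂ) • G (X z T) := by
        rw [Complex.ofReal_add, neg_add_rev, add_smul, neg_smul (T : ℂ)]
      have hcancel : X z T * NormedSpace.exp (-((T : ℂ) • G (X z T))) = 1 :=
        (congrArg (· * _) h2).symm.trans (exp_mul_exp_neg _)
      simp only [hmono, hsplit]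
      rw [Matrix.exp_add_of_commute _ _
        (((Commute.refl (G (X z T))).smul_left _).smul_right _).neg_left, mul_assoc (X z t),
        ← mul_assoc (X z T), hcancel, one_mul]
    · have hcancel : (fun s : ℝ => X z s * NormedSpace.exp (-(s : ℂ) • G (X z T)) *
          NormedSpace.exp ((s : ℂ) • G (X z T))) = X z := by
        funext s
        have := exp_mul_exp_neg (-((s : ℂ) • G (X z T)))
        rw [neg_neg] at this
        rw [mul_assoc, neg_smul, this, mul_one]
      rw [hcancel]
      exact (congrFun hcancel t).symm ▸ hX z h3 t

end Existence

/-! ### Splitting off the block of a multiple eigenvalue. -/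

section BlockReduction

variable {η κ : Type*} [Fintype η] [DecidableEq η] [Fintype κ] [DecidableEq κ]

/-- A solution `K` of the algebraic Riccati equation makes a block matrix similar to a block
triangular one. -/
theorem charpoly_eq_mul_of_riccati (M : Matrix (η ⊕ κ) (η ⊕ κ) ℂ) (K : Matrix κ η ℂ)
    (hK : M.toBlocks₂₁ + M.toBlocks₂₂ * K = K * (M.toBlocks₁₁ + M.toBlocks₁₂ * K)) :
    M.charpoly = (M.toBlocks₁₁ + M.toBlocks₁₂ * K).charpoly *
      (M.toBlocks₂₂ - K * M.toBlocks₁₂).charpoly := by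
  -- The Riccati equation says that the graph of `K` is invariant under `M`. The first block column
  -- of `P` spans this graph, and `Q` is the inverse of `P`.
  let P : Matrix (η ⊕ κ) (η ⊕ κ) ℂ := Matrix.fromBlocks 1 0 K 1
  let Q : Matrix (η ⊕ κ) (η ⊕ κ) ℂ := Matrix.fromBlocks 1 0 (-K) 1
  have hPQ : P * Q = 1 := by simp [P, Q, Matrix.fromBlocks_multiply]
  have hQMP : Q * M * P = Matrix.fromBlocks (M.toBlocks₁₁ + M.toBlocks₁₂ * K) M.toBlocks₁₂ 0
      (M.toBlocks₂₂ - K * M.toBlocks₁₂) := by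
    conv_lhs => rw [← Matrix.fromBlocks_toBlocks M]
    simp only [P, Q, Matrix.fromBlocks_multiply, Matrix.one_mul, Matrix.mul_one,
      Matrix.zero_mul, Matrix.mul_zero, add_zero, zero_add, Matrix.neg_mul]
    congr 1
    · rw [Matrix.add_mul, Matrix.neg_mul, Matrix.mul_assoc, add_add_add_comm, hK, Matrix.mul_add]
      abel
    · abel
  calc M.charpoly = (P * (Q * M)).charpoly := by rw [← Matrix.mul_assoc, hPQ, Matrix.one_mul]
    _ = (Q * M * P).charpoly := Matrix.charpoly_mul_comm _ _
    _ = _ := by rw [hQMP, Matrix.charpoly_fromBlocks_zero₂₁]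

/-- Implicit function theorem at `z = 0`, `K = 0`: there the Riccati defect is linear in `K`,
multiplying row `k` by `ψ k - c ≠ 0`. Differentiability of the solution and `K 0 = 0` give the bound
`O(z)`. -/
theorem exists_riccati_solution {H : ℂ → Matrix (η ⊕ κ) (η ⊕ κ) ℂ} {c : ℂ} {ψ : κ → ℂ}
    (hH : ∀ x y, AnalyticAt ℂ (fun z => H z x y) 0)
    (hH0 : H 0 = Matrix.fromBlocks (Matrix.diagonal fun _ => c) 0 0 (Matrix.diagonal ψ))
    (hψ : ∀ k, ψ k ≠ c) :
    ∃ K : ℂ → Matrix κ η ℂ, (∀ k p, (fun z => K z k p) =O[𝓝 0] fun z => z) ∧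
      ∀ᶠ z in 𝓝 0, (H z).toBlocks₂₁ + (H z).toBlocks₂₂ * K z =
        K z * ((H z).toBlocks₁₁ + (H z).toBlocks₁₂ * K z) := by
  let f : ℂ × (κ → η → ℂ) → κ → η → ℂ := fun v k p =>
    H v.1 (.inr k) (.inl p) + ∑ l, H v.1 (.inr k) (.inr l) * v.2 l p -
      ∑ q, v.2 k q * (H v.1 (.inl q) (.inl p) + ∑ l, H v.1 (.inl q) (.inr l) * v.2 l p)
  have hf : AnalyticAt ℂ f 0 := by
    have h1 : ∀ x y, AnalyticAt ℂ (fun v : ℂ × (κ → η → ℂ) => H v.1 x y) 0 := fun x y =>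
      AnalyticAt.comp (g := fun z => H z x y) (f := fun v : ℂ × (κ → η → ℂ) => v.1)
        (hH x y) analyticAt_fst
    have h2 : ∀ k p, AnalyticAt ℂ (fun v : ℂ × (κ → η → ℂ) => v.2 k p) 0 := fun k p =>
      (((ContinuousLinearMap.proj (R := ℂ) p).comp (ContinuousLinearMap.proj (R := ℂ)
        (φ := fun _ : κ => η → ℂ) k)).comp (ContinuousLinearMap.snd ℂ ℂ (κ → η → ℂ))).analyticAt 0
    refine analyticAt_pi_iff.2 fun k => analyticAt_pi_iff.2 fun p => ?_
    refine ((h1 _ _).add (Finset.analyticAt_fun_sum _ fun l _ => (h1 _ _).mul (h2 _ _))).sub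
      (Finset.analyticAt_fun_sum _ fun q _ => (h2 _ _).mul ((h1 _ _).add
        (Finset.analyticAt_fun_sum _ fun l _ => (h1 _ _).mul (h2 _ _))))
  have hstrict : HasStrictFDerivAt f (fderiv ℂ f 0) 0 := hf.hasStrictFDerivAt
  let e : (κ → η → ℂ) ≃ₗ[ℂ] (κ → η → ℂ) :=
    LinearEquiv.piCongrRight fun k => LinearEquiv.smulOfNeZero ℂ (η → ℂ) (ψ k - c)
      (sub_ne_zero.2 (hψ k))
  have hf0 : ∀ K : κ → η → ℂ, f (0, K) = e K := fun K => by
    funext k p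
    simp [f, e, hH0, Matrix.diagonal_apply]
    ring
  have hinv : fderiv ℂ f 0 ∘L .inr ℂ ℂ (κ → η → ℂ) = e.toContinuousLinearEquiv := by
    have h1 : HasFDerivAt (fun K : κ → η → ℂ => f (0, K))
        (fderiv ℂ f 0 ∘L .inr ℂ ℂ (κ → η → ℂ)) 0 :=
      HasFDerivAt.comp (g := f) (0 : κ → η → ℂ) hstrict.hasFDerivAt
        (ContinuousLinearMap.inr ℂ ℂ (κ → η → ℂ)).hasFDerivAt
    refine h1.unique ?_
    simp_rw [hf0]
    exact e.toContinuousLinearEquiv.hasFDerivAt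
  have hI : (fderiv ℂ f 0 ∘L .inr ℂ ℂ (κ → η → ℂ)).IsInvertible := ⟨_, hinv.symm⟩
  let K := hstrict.implicitFunctionOfProdDomain hI
  have hK0 : K 0 = 0 :=
    (hstrict.eventually_apply_eq_iff_implicitFunctionOfProdDomain hI).self_of_nhds.1 rfl
  have hKO : K =O[𝓝 0] fun z => z := by
    have h : HasFDerivAt K _ (0 : ℂ) :=
      (hstrict.hasStrictFDerivAt_implicitFunctionOfProdDomain hI).hasFDerivAt
    simpa only [hK0, sub_zero] using h.isBigO_sub
  refine ⟨K, fun k p => (isBigO_pi.1 (isBigO_pi.1 hKO k) p), ?_⟩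
  filter_upwards [hstrict.eventually_apply_implicitFunctionOfProdDomain hI] with z hz
  rw [show f 0 = 0 from (hf0 0).trans (map_zero e)] at hz
  ext k p
  exact sub_eq_zero.1 (congrFun (congrFun hz k) p)

/-- The characteristic polynomial is jointly continuous in the matrix and the point, and it is
nonzero at `(diagonal ψ, c)`. -/
theorem exists_forall_not_isRoot_charpoly {N : ℂ → Matrix κ κ ℂ} {c : ℂ} {ψ : κ → ℂ}
    (hN : Tendsto N (𝓝 0) (𝓝 (Matrix.diagonal ψ))) (hψ : ∀ k, ψ k ≠ c) :
    ∃ δ > 0, ∀ᶠ z in 𝓝 0, ∀ w, ‖w - c‖ < δ → ¬ (N z).charpoly.IsRoot w := by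
  have hcont : Continuous fun p : Matrix κ κ ℂ × ℂ => (Matrix.scalar κ p.2 - p.1).det := by
    refine Continuous.matrix_det (Continuous.sub ?_ continuous_fst)
    exact (continuous_pi fun _ => continuous_snd).matrix_diagonal
  have h0 : (Matrix.scalar κ c - Matrix.diagonal ψ).det ≠ 0 := by
    rw [Matrix.scalar_apply, Matrix.diagonal_sub, Matrix.det_diagonal]
    exact Finset.prod_ne_zero_iff.2 fun k _ => sub_ne_zero.2 (hψ k).symm
  have hev := (hcont.continuousAt (x := (Matrix.diagonal ψ, c))).eventually_ne h0
  rw [nhds_prod_eq, eventually_prod_iff] at hev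
  obtain ⟨pa, hpa, pb, hpb, hp⟩ := hev
  obtain ⟨δ, hδ, hball⟩ := Metric.eventually_nhds_iff.1 hpb
  refine ⟨δ, hδ, (hN.eventually hpa).mono fun z hz w hw => ?_⟩
  rw [Polynomial.IsRoot.def, Matrix.eval_charpoly]
  exact hp hz (hball (by rwa [dist_eq_norm]))

end BlockReduction

/-! ### Eigenvalues of a perturbed `2 × 2` scalar matrix. -/

section TwoByTwo

/-- Of the two square roots, one takes the one nearer to `w`. This labels the two eigenvalues for
each parameter separately, without a continuous branch of the root. -/
theorem exists_sq_eq_and_norm_sub_le (d w : ℂ) :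
    ∃ s : ℂ, s ^ 2 = d ∧ ‖s - w‖ ≤ ‖s + w‖ := by
  obtain ⟨s, hs⟩ := IsAlgClosed.exists_pow_nat_eq d two_pos
  rcases le_total ‖s - w‖ ‖s + w‖ with h | h
  · exact ⟨s, hs, h⟩
  · refine ⟨-s, by rw [neg_sq, hs], ?_⟩
    rwa [← norm_neg, ← norm_neg (-s + w), neg_sub, sub_neg_eq_add, neg_add, neg_neg,
      ← sub_eq_add_neg, add_comm]

theorem roots_charpoly_fin_two {M : Matrix (Fin 2) (Fin 2) ℂ} {s : ℂ}
    (hs : s ^ 2 = ((M 0 0 - M 1 1) / 2) ^ 2 + M 0 1 * M 1 0) :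
    M.charpoly.roots = {(M 0 0 + M 1 1) / 2 + s, (M 0 0 + M 1 1) / 2 - s} := by
  have h : M.charpoly = (Polynomial.X - Polynomial.C ((M 0 0 + M 1 1) / 2 + s)) *
      (Polynomial.X - Polynomial.C ((M 0 0 + M 1 1) / 2 - s)) := by
    have htr : M.trace = ((M 0 0 + M 1 1) / 2 + s) + ((M 0 0 + M 1 1) / 2 - s) := by
      rw [Matrix.trace_fin_two]; ring
    have hdet : M.det = ((M 0 0 + M 1 1) / 2 + s) * ((M 0 0 + M 1 1) / 2 - s) := by
      rw [Matrix.det_fin_two]; linear_combination hs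
    rw [Matrix.charpoly_fin_two, htr, hdet, Polynomial.C_add, Polynomial.C_mul]
    ring
  rw [h, Polynomial.roots_mul (mul_ne_zero (Polynomial.X_sub_C_ne_zero _)
    (Polynomial.X_sub_C_ne_zero _)), Polynomial.roots_X_sub_C, Polynomial.roots_X_sub_C]
  rfl

/-- The larger factor `y` has norm at least `‖z‖ * ‖s‖`, since `y - x = 2 z s`; dividing the product
by it gains one power of `z`. -/
theorem isBigO_sq_of_mul_isBigO {x y : ℂ → ℂ} {s : ℂ} (hs : s ≠ 0)
    (hle : ∀ z, ‖x z‖ ≤ ‖y z‖) (hxy : ∀ z, y z - x z = 2 * (z * s))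
    (h : (fun z => x z * y z) =O[𝓝 0] fun z => z ^ 3) : x =O[𝓝 0] fun z => z ^ 2 := by
  obtain ⟨C, hC⟩ := h.bound
  refine IsBigO.of_bound (C / ‖s‖) (hC.mono fun z hz => ?_)
  rw [norm_mul, norm_pow] at hz
  have hs' : 0 < ‖s‖ := norm_pos_iff.2 hs
  have hy : ‖z‖ * ‖s‖ ≤ ‖y z‖ := by
    have h1 := norm_sub_le (y z) (x z)
    rw [hxy, norm_mul, norm_mul, Complex.norm_two] at h1
    linarith [hle z]
  rw [norm_pow, div_mul_eq_mul_div, le_div_iff₀ hs']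
  rcases (norm_nonneg z).eq_or_lt with h0 | h0
  -- At `z = 0` no division is possible; there the bound gives `x * y = 0`, and `‖x‖ ≤ ‖y‖` forces
  -- `x = 0`.
  · rw [← h0] at hz ⊢
    have h2 : ‖x z‖ * ‖x z‖ ≤ 0 := by
      have := mul_le_mul_of_nonneg_left (hle z) (norm_nonneg (x z))
      simp at hz
      linarith
    have h3 : ‖x z‖ = 0 := mul_self_eq_zero.1 (le_antisymm h2 (mul_self_nonneg _))
    simp [h3]
  · refine le_of_mul_le_mul_left ?_ h0
    have := mul_le_mul_of_nonneg_left hy (norm_nonneg (x z))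
    nlinarith

theorem isBigO_id_of_isBigO_sub {g : ℂ → ℂ} {b : ℂ}
    (h : (fun z => g z - z * b) =O[𝓝 0] fun z => z ^ 2) : g =O[𝓝 0] fun z => z := by
  have h1 : (fun z : ℂ => z ^ 2) =O[𝓝 0] fun z => z := by
    simpa using (isLittleO_pow_id (𝕜 := ℂ) one_lt_two).isBigO
  have h2 : (fun z : ℂ => z * b) =O[𝓝 0] fun z => z := by
    simpa [mul_comm] using isBigO_const_mul_self b (fun z : ℂ => z) (𝓝 0)
  simpa using (h.trans h1).add h2

theorem isBigO_mul_sub {g h : ℂ → ℂ} {b c : ℂ}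
    (hg : (fun z => g z - z * b) =O[𝓝 0] fun z => z ^ 2)
    (hh : (fun z => h z - z * c) =O[𝓝 0] fun z => z ^ 2) :
    (fun z => g z * h z - z ^ 2 * (b * c)) =O[𝓝 0] fun z => z ^ 3 := by
  have h1 : (fun z => (g z - z * b) * h z) =O[𝓝 0] fun z => z ^ 3 :=
    (hg.mul (isBigO_id_of_isBigO_sub hh)).congr_right fun z => by ring
  have h2 : (fun z => b * (z * (h z - z * c))) =O[𝓝 0] fun z => z ^ 3 :=
    (((isBigO_refl (fun z : ℂ => z) _).mul hh).congr_right fun z => by ring).const_mul_left b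
  exact (h1.add h2).congr_left fun z => by ring

theorem exists_roots_charpoly_fin_two_asymptotics {G : ℂ → Matrix (Fin 2) (Fin 2) ℂ}
    {B : Matrix (Fin 2) (Fin 2) ℂ} {c : ℂ}
    (hG : ∀ p q, (fun z => G z p q - (Matrix.diagonal (fun _ => c) p q + z * B p q)) =O[𝓝 0]
      fun z => z ^ 2)
    {s : ℂ} (hs : s ^ 2 = ((B 0 0 - B 1 1) / 2) ^ 2 + B 0 1 * B 1 0) :
    ∃ μ₁ μ₂ : ℂ → ℂ, (∀ z, (G z).charpoly.roots = {μ₁ z, μ₂ z}) ∧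
      (fun z => μ₁ z - (c + z * ((B 0 0 + B 1 1) / 2 + s))) =o[𝓝 0] (fun z => z) ∧
      (fun z => μ₂ z - (c + z * ((B 0 0 + B 1 1) / 2 - s))) =o[𝓝 0] (fun z => z) ∧
      (s ≠ 0 ∨ (B 0 1 = 0 ∧ B 1 0 = 0) →
        (fun z => μ₁ z - (c + z * ((B 0 0 + B 1 1) / 2 + s))) =O[𝓝 0] (fun z => z ^ 2) ∧
        (fun z => μ₂ z - (c + z * ((B 0 0 + B 1 1) / 2 - s))) =O[𝓝 0] (fun z => z ^ 2)) := by
  choose σ hσ hσle using fun z =>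
    exists_sq_eq_and_norm_sub_le (((G z 0 0 - G z 1 1) / 2) ^ 2 + G z 0 1 * G z 1 0) (z * s)
  have h00 : (fun z => G z 0 0 - (c + z * B 0 0)) =O[𝓝 0] fun z => z ^ 2 := by
    simpa using hG 0 0
  have h11 : (fun z => G z 1 1 - (c + z * B 1 1)) =O[𝓝 0] fun z => z ^ 2 := by
    simpa using hG 1 1
  have h01 : (fun z => G z 0 1 - z * B 0 1) =O[𝓝 0] fun z => z ^ 2 := by
    simpa using hG 0 1
  have h10 : (fun z => G z 1 0 - z * B 1 0) =O[𝓝 0] fun z => z ^ 2 := by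
    simpa using hG 1 0
  have hdiff : (fun z => (G z 0 0 - G z 1 1) / 2 - z * ((B 0 0 - B 1 1) / 2)) =O[𝓝 0]
      fun z => z ^ 2 :=
    ((h00.sub h11).const_mul_left (1 / 2)).congr_left fun z => by ring
  have hmean : (fun z => (G z 0 0 + G z 1 1) / 2 - (c + z * ((B 0 0 + B 1 1) / 2))) =O[𝓝 0]
      fun z => z ^ 2 :=
    ((h00.add h11).const_mul_left (1 / 2)).congr_left fun z => by ring
  -- The product is the discriminant term `σ ^ 2` minus its leading part `z ^ 2 * s ^ 2`.
  have hprod : (fun z => (σ z - z * s) * (σ z + z * s)) =O[𝓝 0] fun z => z ^ 3 :=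
    ((isBigO_mul_sub hdiff hdiff).add (isBigO_mul_sub h01 h10)).congr_left fun z => by
      linear_combination -hσ z + z ^ 2 * hs
  have hsqle : (fun z => (σ z - z * s) ^ 2) =O[𝓝 0] fun z => (σ z - z * s) * (σ z + z * s) :=
    isBigO_of_le _ fun z => by
      rw [sq, norm_mul, norm_mul]
      exact mul_le_mul_of_nonneg_left (hσle z) (norm_nonneg _)
  -- The nearer root satisfies `(σ - z s)² = O(z³)`, so the error is of order `|z|^(3/2)`. This
  -- holds even when `s = 0`.
  have hσo : (fun z => σ z - z * s) =o[𝓝 0] fun z => z :=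
    IsLittleO.of_pow (n := 2)
      ((hsqle.trans hprod).trans_isLittleO (isLittleO_pow_pow (by norm_num))) two_ne_zero
  have hmeano := hmean.trans_isLittleO (g := fun z : ℂ => z ^ 2) (k := fun z => z)
    (by simpa using isLittleO_pow_id (𝕜 := ℂ) one_lt_two)
  refine ⟨fun z => (G z 0 0 + G z 1 1) / 2 + σ z, fun z => (G z 0 0 + G z 1 1) / 2 - σ z,
    fun z => roots_charpoly_fin_two (hσ z),
    (hmeano.add hσo).congr_left fun z => by ring, (hmeano.sub hσo).congr_left fun z => by ring,
    fun hcase => ?_⟩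
  have hσO : (fun z => σ z - z * s) =O[𝓝 0] fun z => z ^ 2 := by
    by_cases hs0 : s = 0
    -- Here `s = 0` and the vanishing off-diagonal entries force `B 0 0 = B 1 1`. All factors in `σ
    -- ^ 2` are then `O(z²)`, so `σ ^ 2 = O(z⁴)`.
    · obtain ⟨hb01, hb10⟩ := hcase.resolve_left (not_not.2 hs0)
      rw [hs0, hb01, zero_mul, add_zero, eq_comm, zero_pow two_ne_zero,
        sq_eq_zero_iff] at hs
      simp only [hs, hb01, hb10, mul_zero, sub_zero] at hdiff h01 h10
      refine IsBigO.of_pow (n := 2) two_ne_zero ?_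
      refine ((hdiff.mul hdiff).add (h01.mul h10)).congr (fun z => ?_) fun z => ?_
      · simp only [Pi.pow_apply]
        rw [hs0, mul_zero, sub_zero, hσ z]
        ring
      · simp only [Pi.pow_apply]
        ring
    · exact isBigO_sq_of_mul_isBigO (y := fun z => σ z + z * s) hs0 hσle (fun z => by ring) hprod
  exact ⟨(hmean.add hσO).congr_left fun z => by ring, (hmean.sub hσO).congr_left fun z => by ring⟩

end TwoByTwo

/-! ### Asymptotics of a double eigenvalue in a larger matrix. -/

section DoubleEigenvalue

theorem isBigO_sub_linear_of_analyticAt {f : ℂ → ℂ} (hf : AnalyticAt ℂ f 0) :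
    (fun z => f z - (f 0 + z * deriv f 0)) =O[𝓝 0] fun z => z ^ 2 := by
  obtain ⟨p, hp⟩ := hf
  have h := hp.isBigO_sub_partialSum_pow 2
  have h0 : p.coeff 0 = f 0 := hp.coeff_zero _
  have h1 : p.coeff 1 = deriv f 0 := hp.deriv.symm
  refine IsBigO.of_norm_right (h.congr (fun z => ?_) fun z => (norm_pow z 2).symm)
  simp [FormalMultilinearSeries.partialSum, Finset.sum_range_succ, h0, h1]

variable {κ : Type*} [Fintype κ] [DecidableEq κ]

theorem exists_double_eigenvalue_asymptotics
    {H : ℂ → Matrix (Fin 2 ⊕ κ) (Fin 2 ⊕ κ) ℂ} {c : ℂ} {ψ : κ → ℂ}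
    (hH : ∀ x y, AnalyticAt ℂ (fun z => H z x y) 0)
    (hH0 : H 0 = Matrix.fromBlocks (Matrix.diagonal fun _ => c) 0 0 (Matrix.diagonal ψ))
    (hψ : ∀ k, ψ k ≠ c) {B : Matrix (Fin 2) (Fin 2) ℂ}
    (hB : ∀ p q, deriv (fun z => H z (.inl p) (.inl q)) 0 = B p q)
    {s : ℂ} (hs : s ^ 2 = ((B 0 0 - B 1 1) / 2) ^ 2 + B 0 1 * B 1 0) :
    ∃ (μ₁ μ₂ : ℂ → ℂ) (δ : ℝ), 0 < δ ∧
      (∀ᶠ z in 𝓝 (0 : ℂ), eigenvaluesNear (H z) c δ = {μ₁ z, μ₂ z}) ∧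
      (fun z => μ₁ z - (c + z * ((B 0 0 + B 1 1) / 2 + s))) =o[𝓝 0] (fun z => z) ∧
      (fun z => μ₂ z - (c + z * ((B 0 0 + B 1 1) / 2 - s))) =o[𝓝 0] (fun z => z) ∧
      (s ≠ 0 ∨ (B 0 1 = 0 ∧ B 1 0 = 0) →
        (fun z => μ₁ z - (c + z * ((B 0 0 + B 1 1) / 2 + s))) =O[𝓝 0] (fun z => z ^ 2) ∧
        (fun z => μ₂ z - (c + z * ((B 0 0 + B 1 1) / 2 - s))) =O[𝓝 0] (fun z => z ^ 2)) := by
  obtain ⟨K, hKO, hK⟩ := exists_riccati_solution hH hH0 hψ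
  have hK0 : ∀ k p, Tendsto (fun z => K z k p) (𝓝 0) (𝓝 0) := fun k p =>
    (hKO k p).trans_tendsto tendsto_id
  have h12 : ∀ p k, (fun z => H z (.inl p) (.inr k)) =O[𝓝 0] fun z => z := fun p k => by
    have h := (hH (.inl p) (.inr k)).differentiableAt.isBigO_sub
    simpa only [hH0, Matrix.fromBlocks_apply₁₂, Matrix.zero_apply, sub_zero] using h
  have hN : Tendsto (fun z => (H z).toBlocks₂₂ - K z * (H z).toBlocks₁₂) (𝓝 0)
      (𝓝 (Matrix.diagonal ψ)) := by
    refine tendsto_pi_nhds.2 fun k => tendsto_pi_nhds.2 fun l => ?_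
    have h1 : Tendsto (fun z => H z (.inr k) (.inr l)) (𝓝 0) (𝓝 (Matrix.diagonal ψ k l)) := by
      have h := (hH (.inr k) (.inr l)).continuousAt.tendsto
      simpa only [hH0, Matrix.fromBlocks_apply₂₂] using h
    have h2 : Tendsto (fun z => ∑ p, K z k p * H z (.inl p) (.inr l)) (𝓝 0) (𝓝 0) := by
      simpa using tendsto_finsetSum Finset.univ fun p _ =>
        (hK0 k p).mul ((h12 p l).trans_tendsto tendsto_id)
    simpa [Matrix.mul_apply, Matrix.toBlocks₂₂, Matrix.toBlocks₁₂] using h1.sub h2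
  have hG : ∀ p q, (fun z => ((H z).toBlocks₁₁ + (H z).toBlocks₁₂ * K z) p q -
      (Matrix.diagonal (fun _ => c) p q + z * B p q)) =O[𝓝 0] fun z => z ^ 2 := fun p q => by
    have h1 := isBigO_sub_linear_of_analyticAt (hH (.inl p) (.inl q))
    -- The off-diagonal block and `K` are both `O(z)`, so the coupling to the other eigenvalues
    -- leaves the first order block unchanged.
    have h2 : (fun z => ∑ k, H z (.inl p) (.inr k) * K z k q) =O[𝓝 0] fun z => z ^ 2 :=
      IsBigO.fun_sum fun k _ => ((h12 p k).mul (hKO k q)).congr_right fun z => (sq z).symm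
    rw [hB, hH0, Matrix.fromBlocks_apply₁₁] at h1
    refine (h1.add h2).congr_left fun z => ?_
    rw [Matrix.add_apply, Matrix.mul_apply]
    simp only [Matrix.toBlocks₁₁, Matrix.toBlocks₁₂, Matrix.of_apply]
    ring
  obtain ⟨μ₁, μ₂, hroots, h₁, h₂, h₃⟩ := exists_roots_charpoly_fin_two_asymptotics hG hs
  obtain ⟨δ, hδ, hne⟩ := exists_forall_not_isRoot_charpoly hN hψ
  refine ⟨μ₁, μ₂, δ, hδ, ?_, h₁, h₂, h₃⟩
  have hnear : ∀ {μ : ℂ → ℂ} {b : ℂ}, (fun z => μ z - (c + z * b)) =o[𝓝 0] (fun z => z) →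
      ∀ᶠ z in 𝓝 0, ‖μ z - c‖ < δ := fun {μ b} hμ => by
    have ht : Tendsto (fun z => μ z - (c + z * b) + z * b) (𝓝 0) (𝓝 (0 + 0 * b)) :=
      (hμ.trans_tendsto tendsto_id).add (tendsto_id.mul_const b)
    rw [zero_mul, add_zero] at ht
    filter_upwards [ht.eventually (Metric.ball_mem_nhds 0 hδ)] with z hz
    have : μ z - (c + z * b) + z * b = μ z - c := by ring
    rwa [this, dist_zero_right] at hz
  -- The `2 × 2` block contributes both of its roots to the disc of radius `δ`, the complementary
  -- block none.
  filter_upwards [hK, hne, hnear h₁, hnear h₂] with z hzK hzne hz₁ hz₂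
  rw [eigenvaluesNear, charpoly_eq_mul_of_riccati _ _ hzK, Polynomial.roots_mul
    (mul_ne_zero (Matrix.charpoly_monic _).ne_zero (Matrix.charpoly_monic _).ne_zero),
    Multiset.filter_add, hroots, Multiset.filter_eq_self.2, Multiset.filter_eq_nil.2, add_zero]
  · exact fun w hw hwδ => hzne w hwδ (Polynomial.isRoot_of_mem_roots hw)
  · intro w hw
    rcases Multiset.mem_cons.1 hw with rfl | hw
    · exact hz₁
    · rw [Multiset.mem_singleton.1 hw]
      exact hz₂

end DoubleEigenvalue

end FloquetPerturbation

/-! ### The main theorem. -/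

open FloquetPerturbation in
theorem mainTheorem6 {ι : Type*} [Fintype ι] [DecidableEq ι]
    (T r₀ : ℝ) (hT : 0 < T) (hr₀ : 0 < r₀)
    (A : ℂ → ℝ → Matrix ι ι ℂ) (a : ℕ → ℝ → Matrix ι ι ℂ) (α : ι → ℂ)
    (hA : IsAnalyticPeriodicFamily T r₀ A a α)
    (φ : ι → ℂ) (n : ι → ℤ) (hφ : IsConstantOrderExponent T α φ n)
    (i j : ι) (hij : i ≠ j) (heq : φ i = φ j)
    (hdouble : ∀ k, φ k = φ i → k = i ∨ k = j)
    (bii bij bji bjj : ℂ)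
    (hbii : bii = fourierCoefficient hT (a 1) 0 i i)
    (hbij : bij = fourierCoefficient hT (a 1) (n i - n j) i j)
    (hbji : bji = fourierCoefficient hT (a 1) (n j - n i) j i)
    (hbjj : bjj = fourierCoefficient hT (a 1) 0 j j) :
    (∃ F P, IsAnalyticFloquetDecomposition T A φ F P) ∧
    ∀ F P, IsAnalyticFloquetDecomposition T A φ F P →
      (∀ ε : ℂ,
        (effectiveHamiltonian φ (firstOrderCoefficient F) i ε).submatrix
            ![⟨i, rfl⟩, ⟨j, heq.symm⟩] ![⟨i, rfl⟩, ⟨j, heq.symm⟩] =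
          !![φ i, 0; 0, φ j] + ε • !![bii, bij; bji, bjj]) ∧
      ∀ s : ℂ, s ^ 2 = ((bii - bjj) / 2) ^ 2 + bij * bji →
        ∃ (μ₁ μ₂ : ℂ → ℂ) (δ : ℝ), 0 < δ ∧
          (∀ᶠ ε in 𝓝 (0 : ℂ), eigenvaluesNear (F ε) (φ i) δ = {μ₁ ε, μ₂ ε}) ∧
          (fun ε => μ₁ ε - (φ i + ε * ((bii + bjj) / 2 + s))) =o[𝓝 (0 : ℂ)] (fun ε => ε) ∧
          (fun ε => μ₂ ε - (φ i + ε * ((bii + bjj) / 2 - s))) =o[𝓝 (0 : ℂ)] (fun ε => ε) ∧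
          (s ≠ 0 ∨ (bij = 0 ∧ bji = 0) →
            (fun ε => μ₁ ε - (φ i + ε * ((bii + bjj) / 2 + s))) =O[𝓝 (0 : ℂ)]
              (fun ε => ε ^ 2) ∧
            (fun ε => μ₂ ε - (φ i + ε * ((bii + bjj) / 2 - s))) =O[𝓝 (0 : ℂ)]
              (fun ε => ε ^ 2)) := by
  refine ⟨exists_isAnalyticFloquetDecomposition hT hr₀ hA hφ, fun F P hFP => ?_⟩
  have hF1 : ∀ k l, φ k = φ l → deriv (fun ε => F ε k l) 0 =
      fourierCoefficient hT (a 1) (n k - n l) k l := fun k l hkl =>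
    hFP.firstOrderCoefficient_apply hT hr₀ hA hφ hkl
  have hii : deriv (fun ε => F ε i i) 0 = bii := by rw [hF1 i i rfl, sub_self, hbii]
  have hij' : deriv (fun ε => F ε i j) 0 = bij := by rw [hF1 i j heq, hbij]
  have hji' : deriv (fun ε => F ε j i) 0 = bji := by rw [hF1 j i heq.symm, hbji]
  have hjj : deriv (fun ε => F ε j j) 0 = bjj := by rw [hF1 j j rfl, sub_self, hbjj]
  refine ⟨fun ε => ?_, fun s hs => ?_⟩
  · ext p q
    fin_cases p <;> fin_cases q <;>
      simp [effectiveHamiltonian, firstOrderCoefficient, hii, hij', hji', hjj, hij, hij.symm]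
  -- The basis is reordered so that `i`, `j` come first. By `hdouble` the remaining indices are
  -- exactly those with `φ k ≠ φ i`.
  · have hbijective : Function.Bijective
        (Sum.elim ![i, j] (Subtype.val : {k : ι // φ k ≠ φ i} → ι)) := by
      constructor
      · refine Function.Injective.sumElim ?_ Subtype.val_injective ?_
        · intro p q
          fin_cases p <;> fin_cases q <;> simp [hij, hij.symm]
        · intro p k h
          refine k.2 (h ▸ ?_)
          fin_cases p <;> simp [heq]
      · intro k
        by_cases hk : φ k = φ i
        · rcases hdouble k hk with rfl | rfl
          · exact ⟨.inl 0, rfl⟩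
          · exact ⟨.inl 1, rfl⟩
        · exact ⟨.inr ⟨k, hk⟩, rfl⟩
    let e := Equiv.ofBijective _ hbijective
    have hmain := exists_double_eigenvalue_asymptotics
      (H := fun ε => Matrix.reindex e.symm e.symm (F ε)) (c := φ i)
      (ψ := fun k : {k : ι // φ k ≠ φ i} => φ k)
      (fun x y => analyticAt_entry hFP.analyticAt (e x) (e y)) ?_ (fun k => k.2)
      (B := !![bii, bij; bji, bjj]) ?_ (s := s) hs
    · simp only [eigenvaluesNear, Matrix.charpoly_reindex] at hmain ⊢
      exact hmain
    · simp only [hFP.1, Matrix.reindex_apply, Equiv.symm_symm,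
        Matrix.submatrix_diagonal_equiv, Matrix.fromBlocks_diagonal]
      congr 1
      funext x
      rcases x with p | k
      · fin_cases p
        · rfl
        · exact heq.symm
      · rfl
    · intro p q
      fin_cases p <;> fin_cases q
      · exact hii
      · exact hij'
      · exact hji'
      · exact hjj
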